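/- Let $N\ge 1$ and let $(x_j,m_j,n_j)_{1\le j\le N}$ be any initial condition in the pure peakon region $$\mathcal P=\{x_1<x_2<\dots<x_N,\ m_j>0,\ n_j>0 \text{ for all } 1\le j\le N\}.$$ Put $\mathbf m_j=\begin{bmatrix} m_j\\ n_j\end{bmatrix}$, $\mathbf m_j^*=[\,n_j,\ m_j\,]$, $\langle \mathbf m_j,\mathbf m_j\rangle=2m_jn_j$, and define the functions $A(\lambda)$, $\mathbf B(\lambda)\in\mathbb C^2$, $C(\lambda)$, polynomial in $\lambda\in\mathbb C$, by $$\begin{bmatrix}A(\lambda)\\ \mathbf B(\lambda)\\ C(\lambda)\end{bmatrix}=S_N(\lambda)\cdots S_1(\lambda)\begin{bmatrix}1\\0_{2\times1}\\0\end{bmatrix},\qquad S_k(\lambda)=\begin{bmatrix}1-\lambda\langle\mathbf m_k,\mathbf m_k\rangle&-2\lambda\,\mathbf m_k^*e^{-x_k}&-\lambda^2\langle\mathbf m_k,\mathbf m_k\rangle e^{-2x_k}\\ \mathbf m_ke^{x_k}&\mathbf 1_2&\lambda\,\mathbf m_ke^{-x_k}\\ \langle\mathbf m_k,\mathbf m_k\rangle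 e^{2x_k}&2\,\mathbf m_k^*e^{x_k}&1+\lambda\langle\mathbf m_k,\mathbf m_k\rangle\end{bmatrix},$$ and the vector Weyl function by $\mathbf W(\lambda)=-\mathbf B(\lambda)/A(\lambda)$. Let $M=(T\otimes\mathbf 1_2)\,P\,E\,P^*\in\mathbb R^{2N\times 2N}$, where $T_{ij}=1$ if $i=j$, $T_{ij}=2$ if $i>j$ and $T_{ij}=0$ if $i<j$; $E_{ij}=e^{-|x_i-x_j|}$; $P\in\mathbb R^{2N\times N}$ is block diagonal with blocks $\mathbf m_1,\dots,\mathbf m_N$; and $P^*\in\mathbb R^{N\times 2N}$ is block diagonal with blocks $\mathbf m_1^*,\dots,\mathbf m_N^*$. Then the set of all $\lambda\in\mathbb C$ for which $\Psi=\lambda M\Psi$ has a solution $\Psi\in\mathbb C^{2N}\setminus\{0\}$ (the reciprocals of the non-zero eigenvalues of $M$) consists of exactly $N$ numbers, all real and positive, $\lambda_1>\lambda_2>\dots>\lambda_N>0$; and for every $1\le j\le N$ the function $\mathbf W$ has a simple pole at $\lambda_j$ whose residue is a real vector with both components strictly positive: $$\operatorname{Res}\{\mathbf W;\lambda_j\}>0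 .$$ -/

import Mathlib

open scoped Topology Kronecker Matrix

noncomputable section

namespace TwoNovikov

/-- The pure peakon region: ordered positions and positive momenta. -/
def PurePeakon {N : ℕ} (x m n : Fin N → ℝ) : Prop :=
  StrictMono x ∧ ∀ j, 0 < m j ∧ 0 < n j

/-- The symmetric bilinear form `⟨u, w⟩ = u₁ w₂ + u₂ w₁`. -/
def form (u w : Fin 2 → ℝ) : ℝ := u 0 * w 1 + u 1 * w 0

/-- The vector `𝐦_j = (m_j, n_j)ᵀ`. -/
def vec {N : ℕ} (m n : Fin N → ℝ) (j : Fin N) : Fin 2 → ℝ := ![m j, n j]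

/-- The dual row vector `𝐦_j^* = (n_j, m_j)`. -/
def dualVec {N : ℕ} (m n : Fin N → ℝ) (j : Fin N) : Fin 2 → ℝ := ![n j, m j]

/-- The one-step transition matrix `S_k(z)`, written out with respect to the block
decomposition `1 + 2 + 1` of the index set. -/
def transition {N : ℕ} (x m n : Fin N → ℝ) (k : Fin N) (z : ℂ) : Matrix (Fin 4) (Fin 4) ℂ :=
  let p : ℂ := (form (vec m n k) (vec m n k) : ℝ)
  let e : ℂ := (Real.exp (x k) : ℝ)
  let e' : ℂ := (Real.exp (-x k) : ℝ)
  let μ : Fin 2 → ℂ := fun a => (vec m n k a : ℝ)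
  let μ' : Fin 2 → ℂ := fun a => (dualVec m n k a : ℝ)
  !![1 - z * p,  -2 * z * μ' 0 * e', -2 * z * μ' 1 * e', -z ^ 2 * p * e' ^ 2;
     μ 0 * e,    1,                  0,                  z * μ 0 * e';
     μ 1 * e,    0,                  1,                  z * μ 1 * e';
     p * e ^ 2,  2 * μ' 0 * e,       2 * μ' 1 * e,       1 + z * p]

/-- The coefficient vector `(A_k, 𝐁_k, C_k)(z)`, obtained from `(1, 0, 0, 0)` by the successive
transitions `S_1, …, S_k` (it stays constant for `k ≥ N`; the site with number `k + 1` is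
indexed by `k : Fin N`). -/
def coeffs {N : ℕ} (x m n : Fin N → ℝ) (z : ℂ) : ℕ → Fin 4 → ℂ
  | 0 => ![1, 0, 0, 0]
  | k + 1 =>
    if h : k < N then transition x m n ⟨k, h⟩ z *ᵥ coeffs x m n z k else coeffs x m n z k

/-- `A = A_N`. -/
def coeffA {N : ℕ} (x m n : Fin N → ℝ) (z : ℂ) : ℂ := coeffs x m n z N 0

/-- `𝐁 = 𝐁_N`. -/
def coeffB {N : ℕ} (x m n : Fin N → ℝ) (z : ℂ) : Fin 2 → ℂ :=
  ![coeffs x m n z N 1, coeffs x m n z N 2]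

/-- The vector Weyl function `𝐖 = -𝐁 / A`. -/
def weylW {N : ℕ} (x m n : Fin N → ℝ) (z : ℂ) : Fin 2 → ℂ :=
  -((coeffA x m n z)⁻¹ • coeffB x m n z)

/-- The lower triangular matrix `T`: `1` on the diagonal, `2` below it. -/
def matT (N : ℕ) : Matrix (Fin N) (Fin N) ℝ :=
  Matrix.of fun i j => if i = j then 1 else if j < i then 2 else 0

/-- The matrix `E` with entries `exp (-|x_i - x_j|)`. -/
def matE {N : ℕ} (x : Fin N → ℝ) : Matrix (Fin N) (Fin N) ℝ :=
  Matrix.of fun i j => Real.exp (-|x i - x j|)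

/-- The block diagonal `2N × N` matrix `P` with the columns `𝐦_j` on the diagonal. -/
def matP {N : ℕ} (m n : Fin N → ℝ) : Matrix (Fin N × Fin 2) (Fin N) ℝ :=
  Matrix.of fun ia j => if ia.1 = j then vec m n j ia.2 else 0

/-- The block diagonal `N × 2N` matrix `P^*` with the rows `𝐦_j^*` on the diagonal. -/
def matPstar {N : ℕ} (m n : Fin N → ℝ) : Matrix (Fin N) (Fin N × Fin 2) ℝ :=
  Matrix.of fun i jb => if i = jb.1 then dualVec m n i jb.2 else 0

/-- The `2N × 2N` matrix `(T ⊗ 𝟏) P E P^*`. -/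
def spectralMatrix {N : ℕ} (x m n : Fin N → ℝ) : Matrix (Fin N × Fin 2) (Fin N × Fin 2) ℝ :=
  (matT N ⊗ₖ (1 : Matrix (Fin 2) (Fin 2) ℝ)) * matP m n * matE x * matPstar m n

/-- The complex numbers `z` for which `Ψ = z (T ⊗ 𝟏) P E P^* Ψ` has a solution `Ψ ≠ 0`,
that is, the reciprocals of the non-zero eigenvalues of `(T ⊗ 𝟏) P E P^*`. -/
def spectrumSet {N : ℕ} (x m n : Fin N → ℝ) : Set ℂ :=
  {z | ∃ Ψ : Fin N × Fin 2 → ℂ, Ψ ≠ 0 ∧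
    Ψ = z • (((spectralMatrix x m n).map (fun r : ℝ => (r : ℂ))) *ᵥ Ψ)}

/-- `f` has residue `c` at `p`, where `f` has at most a simple pole: near `p`,
`f z = c / (z - p) +` an analytic function. -/
def HasSimpleResidue (f : ℂ → Fin 2 → ℂ) (p : ℂ) (c : Fin 2 → ℂ) : Prop :=
  ∃ g : ℂ → Fin 2 → ℂ, AnalyticAt ℂ g p ∧ ∀ᶠ z in 𝓝[≠] p, f z = (z - p)⁻¹ • c + g z

end TwoNovikov

end

/-! ### The jump recursion over an arbitrary commutative real algebra, and its orthogonality
relation -/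

noncomputable section

namespace TwoNovikov

open Polynomial

/-! Write `U_k = A_k e^{x_k} + z C_k e^{-x_k}` for the wave arriving at the next peakon. An
eigenvector of `M` is, up to a factor, the sequence `z (𝐁_k + 𝐁_{k+1})` of a solution of the jump
recursion, and the condition at the right end is `A_N(z) = 0`; so the spectrum is the zero set of
`A_N` (`mem_spectrumSet_iff_state_a`). It remains to locate these zeros and to find the sign of `𝐁`
there. Two identities control signs. The energy, that is wave times derivative plus `4 z B₁ B₂`, is
preserved by jumps and nondecreasing between them, so it stays positive; hence `B₁ B₂ > 0` wherever
`A_k` or `U_k` vanishes at some `z > 0`. The pairing of the states at `z` and `-z` is conserved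
(`state_isotropic`), and the state at `-z < 0` has nonnegative entries, so this common sign of `B₁,
B₂` is that of `C` at a zero of `A_k` and is opposite to that of `A_k` at a zero of `U_k`. The zeros
then follow by a double interlacing (`exists_roots_a`). The signs of `C_k` alternate at the zeros of
`A_k`, so `U_k` has exactly one zero to the right of each of them and before the next. At the zeros
of `U_k` the jump preserves the sign of `A`, so together with `A_{k+1}(0) = 1` they separate the
zeros of `A_{k+1}`. The wave is continuous across the jump, which restores the alternation for
`C_{k+1}`. Finally `-𝐁/A` has residue `-𝐁/A'` at a zero of `A`. Both `-A'` and `C` have the sign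
`(-1)^j` at the `j`-th zero, counted upwards from zero, and `𝐁` has the sign of `C`, so the residue
is positive. -/

/-- A coefficient vector `(A, B₁, B₂, C)`. -/
@[ext] structure State (R : Type*) where
  /-- the coefficient `A` -/
  a : R
  /-- the first component of `𝐁` -/
  b₁ : R
  /-- the second component of `𝐁` -/
  b₂ : R
  /-- the coefficient `C` -/
  c : R

section Algebra

variable {R : Type*} [CommRing R] [Algebra ℝ R]

/-- The wave function `A e^y + z C e^{-y}`. -/
def State.wave (s : State R) (z : R) (y : ℝ) : R :=
  algebraMap ℝ R (Real.exp y) * s.a + z * algebraMap ℝ R (Real.exp (-y)) * s.c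

/-- The quantity `⟨𝐦, 𝐁 + 𝐁'⟩`, where `𝐁'` is the vector after the jump at `y`. -/
def State.kick (s : State R) (z : R) (y m n : ℝ) : R :=
  algebraMap ℝ R n * (2 * s.b₁ + algebraMap ℝ R m * s.wave z y) +
    algebraMap ℝ R m * (2 * s.b₂ + algebraMap ℝ R n * s.wave z y)

/-- The jump of the coefficient vector at a peakon `(y, m, n)`. -/
def State.jump (s : State R) (z : R) (y m n : ℝ) : State R where
  a := s.a - z * algebraMap ℝ R (Real.exp (-y)) * s.kick z y m n
  b₁ := s.b₁ + algebraMap ℝ R m * s.wave z y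
  b₂ := s.b₂ + algebraMap ℝ R n * s.wave z y
  c := s.c + algebraMap ℝ R (Real.exp y) * s.kick z y m n

/-- The coefficient vector after the first `k` peakons. -/
def state (x m n : ℕ → ℝ) (z : R) : ℕ → State R
  | 0 => ⟨1, 0, 0, 0⟩
  | k + 1 => (state x m n z k).jump z (x k) (m k) (n k)

/-- The image of a coefficient vector. -/
def State.map {S : Type*} (f : R → S) (s : State R) : State S := ⟨f s.a, f s.b₁, f s.b₂, f s.c⟩

theorem State.wave_map {S : Type*} [CommRing S] [Algebra ℝ S] (f : R →ₐ[ℝ] S) (s : State R)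
    (z : R) (y : ℝ) : (s.map f).wave (f z) y = f (s.wave z y) := by
  simp [State.wave, State.map]

theorem State.kick_map {S : Type*} [CommRing S] [Algebra ℝ S] (f : R →ₐ[ℝ] S) (s : State R)
    (z : R) (y m n : ℝ) : (s.map f).kick (f z) y m n = f (s.kick z y m n) := by
  simp only [State.kick, State.wave_map]
  simp [State.map, map_ofNat]

/-- Allows one recursion to serve as polynomials in `ℝ[X]`, as real values for sign arguments, and
as complex values for the spectrum and residues. -/
theorem state_map {S : Type*} [CommRing S] [Algebra ℝ S] (f : R →ₐ[ℝ] S) (x m n : ℕ → ℝ)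
    (z : R) (k : ℕ) : state x m n (f z) k = (state x m n z k).map f := by
  induction k with
  | zero => simp [state, State.map]
  | succ k ih =>
    simp only [state, ih, State.jump, State.wave_map, State.kick_map]
    simp [State.map]

/-- The contributions of the kick to `A` and `C` cancel at the peakon itself: the wave is continuous
and only its derivative jumps. -/
theorem State.wave_jump (s : State R) (z : R) (y m n : ℝ) :
    (s.jump z y m n).wave z y = s.wave z y := by
  simp only [State.wave, State.jump]
  ring

/-- The coefficient vectors at `z` and `-z` are orthogonal. -/
theorem state_isotropic (x m n : ℕ → ℝ) (z : R) (k : ℕ) :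
    (state x m n z k).a * (state x m n (-z) k).c + (state x m n z k).c * (state x m n (-z) k).a =
      2 * ((state x m n z k).b₁ * (state x m n (-z) k).b₂ +
        (state x m n z k).b₂ * (state x m n (-z) k).b₁) := by
  induction k with
  | zero => simp [state]
  | succ k ih =>
    simp only [state]
    generalize state x m n z k = s at *
    generalize state x m n (-z) k = t at *
    have hu : ∀ w : R, ∀ r : State R, r.kick w (x k) (m k) (n k) = algebraMap ℝ R (n k) *
        (2 * r.b₁ + algebraMap ℝ R (m k) * r.wave w (x k)) +
        algebraMap ℝ R (m k) * (2 * r.b₂ + algebraMap ℝ R (n k) * r.wave w (x k)) := fun _ _ => rfl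
    have hs : s.wave z (x k) = algebraMap ℝ R (Real.exp (x k)) * s.a +
      z * algebraMap ℝ R (Real.exp (-x k)) * s.c := rfl
    have ht : t.wave (-z) (x k) = algebraMap ℝ R (Real.exp (x k)) * t.a +
      -z * algebraMap ℝ R (Real.exp (-x k)) * t.c := rfl
    have hks := hu z s
    have hkt := hu (-z) t
    simp only [State.jump]
    generalize s.kick z (x k) (m k) (n k) = ks at *
    generalize t.kick (-z) (x k) (m k) (n k) = kt at *
    generalize s.wave z (x k) = us at *
    generalize t.wave (-z) (x k) = ut at *
    -- Both sides change by `us * kt + ut * ks`; the terms in `ks * kt` cancel because the spectral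
    -- parameters are opposite.
    linear_combination ih - kt * hs - ks * ht + us * hkt + ut * hks

end Algebra

/-! ### Sign information from positivity, energy and orthogonality -/

section Sign

variable {x m n : ℕ → ℝ}

theorem wave_real (s : State ℝ) (z y : ℝ) :
    s.wave z y = Real.exp y * s.a + z * Real.exp (-y) * s.c := rfl

/-- For `z ≤ 0` all coefficients are nonnegative. -/
theorem state_nonneg (hx : StrictMono x) (hm : ∀ k, 0 < m k) (hn : ∀ k, 0 < n k) {z : ℝ}
    (hz : z ≤ 0) (k : ℕ) :
    0 < (state x m n z k).a ∧ 0 ≤ (state x m n z k).b₁ ∧ 0 ≤ (state x m n z k).b₂ ∧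
      0 ≤ (state x m n z k).c ∧ 0 < (state x m n z k).wave z (x k) := by
  induction k with
  | zero => simp [state, State.wave, Real.exp_pos]
  | succ k ih =>
    obtain ⟨ha, hb₁, hb₂, hc, hu⟩ := ih
    have hw := State.wave_jump (state x m n z k) z (x k) (m k) (n k)
    simp only [state]
    generalize state x m n z k = s at *
    have hmk := hm k
    have hnk := hn k
    have hD : 0 < s.kick z (x k) (m k) (n k) := by
      simp only [State.kick, Algebra.algebraMap_self, RingHom.id_apply]
      positivity
    have ha' : 0 < (s.jump z (x k) (m k) (n k)).a := by
      simp only [State.jump, Algebra.algebraMap_self, RingHom.id_apply]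
      have : 0 ≤ -z * Real.exp (-x k) * s.kick z (x k) (m k) (n k) := by
        have : 0 ≤ -z := by linarith
        positivity
      linarith
    have hc' : 0 ≤ (s.jump z (x k) (m k) (n k)).c := by
      simp only [State.jump, Algebra.algebraMap_self, RingHom.id_apply]
      positivity
    refine ⟨ha', ?_, ?_, hc', ?_⟩
    · simp only [State.jump, Algebra.algebraMap_self, RingHom.id_apply]
      positivity
    · simp only [State.jump, Algebra.algebraMap_self, RingHom.id_apply]
      positivity
    · rw [wave_real] at hw ⊢
      -- Between peakons the wave cannot decrease, since `A > 0` and `z C ≤ 0`.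
      have h1 : Real.exp (x k) ≤ Real.exp (x (k + 1)) :=
        Real.exp_le_exp.2 (hx (Nat.lt_succ_self k)).le
      have h2 : Real.exp (-x (k + 1)) ≤ Real.exp (-x k) :=
        Real.exp_le_exp.2 (neg_le_neg (hx (Nat.lt_succ_self k)).le)
      have h3 := mul_le_mul_of_nonneg_right h1 ha'.le
      have h4 := mul_le_mul_of_nonneg_left h2
        (mul_nonneg (neg_nonneg.2 hz) hc')
      nlinarith

theorem state_b_pos (hx : StrictMono x) (hm : ∀ k, 0 < m k) (hn : ∀ k, 0 < n k) {z : ℝ}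
    (hz : z ≤ 0) (k : ℕ) :
    0 < (state x m n z (k + 1)).b₁ ∧ 0 < (state x m n z (k + 1)).b₂ := by
  obtain ⟨-, hb₁, hb₂, -, hu⟩ := state_nonneg hx hm hn hz k
  have hmk := hm k
  have hnk := hn k
  constructor <;> simp only [state, State.jump, Algebra.algebraMap_self, RingHom.id_apply] <;>
    positivity

/-- The product of the wave function and its derivative, corrected by `4 z B₁ B₂`. -/
def State.energy (s : State ℝ) (z y : ℝ) : ℝ :=
  (Real.exp y * s.a) ^ 2 - (z * Real.exp (-y) * s.c) ^ 2 + 4 * z * s.b₁ * s.b₂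

/-- The wave `u` is continuous and its derivative drops by `2 z` times the kick, so their product
drops by `2 z u` times the kick; `4 z B₁ B₂` gains exactly this amount. -/
theorem State.energy_jump (s : State ℝ) (z y m n : ℝ) :
    (s.jump z y m n).energy z y = s.energy z y := by
  have he : Real.exp y * Real.exp (-y) = 1 := by rw [← Real.exp_add]; simp
  have hs : s.wave z y = Real.exp y * s.a + z * Real.exp (-y) * s.c := rfl
  have hk : s.kick z y m n =
    n * (2 * s.b₁ + m * s.wave z y) + m * (2 * s.b₂ + n * s.wave z y) := rfl
  simp only [State.energy, State.jump, Algebra.algebraMap_self, RingHom.id_apply]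
  generalize s.kick z y m n = k at *
  generalize s.wave z y = u at *
  linear_combination (-2 * z * k * Real.exp y * s.a - 2 * z * k * Real.exp (-y) * z * s.c) * he +
    2 * z * k * hs - 2 * z * u * hk

theorem State.energy_mono (s : State ℝ) (z : ℝ) : Monotone (s.energy z) := by
  intro y y' h
  have h1 : Real.exp y ≤ Real.exp y' := Real.exp_le_exp.2 h
  have h2 : Real.exp (-y') ≤ Real.exp (-y) := Real.exp_le_exp.2 (neg_le_neg h)
  have h3 : (Real.exp y) ^ 2 * s.a ^ 2 ≤ (Real.exp y') ^ 2 * s.a ^ 2 := by gcongr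
  have h4 : (Real.exp (-y')) ^ 2 * (z * s.c) ^ 2 ≤ (Real.exp (-y)) ^ 2 * (z * s.c) ^ 2 := by gcongr
  simp only [State.energy]
  nlinarith

theorem energy_state_pos (hx : StrictMono x) (z : ℝ) (k : ℕ) :
    0 < (state x m n z k).energy z (x k) := by
  induction k with
  | zero => simp [state, State.energy, Real.exp_pos]
  | succ k ih =>
    refine lt_of_lt_of_le ?_ (State.energy_mono _ z (hx (Nat.lt_succ_self k)).le)
    rwa [state, State.energy_jump]

theorem b_mul_b_pos (hx : StrictMono x) {z : ℝ} (hz : 0 < z) {k : ℕ}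
    (h : (state x m n z (k + 1)).a = 0) :
    0 < (state x m n z (k + 1)).b₁ * (state x m n z (k + 1)).b₂ := by
  have := energy_state_pos (m := m) (n := n) hx z (k + 1)
  rw [State.energy, h] at this
  have h2 : 0 < 4 * z * ((state x m n z (k + 1)).b₁ * (state x m n z (k + 1)).b₂) := by
    nlinarith [sq_nonneg (z * Real.exp (-x (k + 1)) * (state x m n z (k + 1)).c)]
  exact pos_of_mul_pos_right h2 (by positivity)

/-- At a positive zero of `A`, the components of `𝐁` have the sign of `C`. -/
theorem c_mul_b_pos (hx : StrictMono x) (hm : ∀ k, 0 < m k) (hn : ∀ k, 0 < n k) {z : ℝ}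
    (hz : 0 < z) {k : ℕ} (h : (state x m n z (k + 1)).a = 0) :
    0 < (state x m n z (k + 1)).c * (state x m n z (k + 1)).b₁ ∧
      0 < (state x m n z (k + 1)).c * (state x m n z (k + 1)).b₂ := by
  have hbb := b_mul_b_pos hx hz h
  have hI := state_isotropic x m n z (k + 1)
  have hz' : -z ≤ 0 := by linarith
  obtain ⟨ha, -⟩ := state_nonneg hx hm hn hz' (k + 1)
  obtain ⟨h₁, h₂⟩ := state_b_pos hx hm hn hz' k
  generalize state x m n z (k + 1) = s at *
  generalize state x m n (-z) (k + 1) = t at *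
  rw [h, zero_mul, zero_add] at hI
  constructor
  · have : s.c * s.b₁ * t.a = 2 * (s.b₁ ^ 2 * t.b₂ + s.b₁ * s.b₂ * t.b₁) := by
      linear_combination s.b₁ * hI
    refine pos_of_mul_pos_left (this ▸ ?_) ha.le
    positivity
  · have : s.c * s.b₂ * t.a = 2 * (s.b₁ * s.b₂ * t.b₂ + s.b₂ ^ 2 * t.b₁) := by
      linear_combination s.b₂ * hI
    refine pos_of_mul_pos_left (this ▸ ?_) ha.le
    positivity

/-- At a positive zero of the wave function at the next peakon, `A` keeps its sign. -/
theorem sq_a_le_of_wave_eq_zero (hx : StrictMono x) (hm : ∀ k, 0 < m k) (hn : ∀ k, 0 < n k)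
    {z : ℝ} (hz : 0 < z) {k : ℕ} (h : (state x m n z k).wave z (x k) = 0) :
    (state x m n z k).a ^ 2 ≤ (state x m n z k).a * (state x m n z (k + 1)).a := by
  have hE := energy_state_pos (m := m) (n := n) hx z k
  have hI := state_isotropic x m n z k
  have hz' : -z ≤ 0 := by linarith
  obtain ⟨-, h₁, h₂, -, hu⟩ := state_nonneg hx hm hn hz' k
  have he : Real.exp (x k) * Real.exp (-x k) = 1 := by rw [← Real.exp_add]; simp
  have hmk := hm k
  have hnk := hn k
  simp only [state, State.jump, State.kick, h, Algebra.algebraMap_self, RingHom.id_apply]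
  rw [State.energy] at hE
  rw [wave_real] at h hu
  have hep := Real.exp_pos (x k)
  have hep' := Real.exp_pos (-x k)
  generalize state x m n z k = s at *
  generalize state x m n (-z) k = t at *
  generalize Real.exp (x k) = e at *
  generalize Real.exp (-x k) = e' at *
  -- The wave is a factor of the first part of the energy, so only `4 z B₁ B₂` remains.
  have hbb : 0 < s.b₁ * s.b₂ := by
    refine pos_of_mul_pos_right (a := 4 * z) ?_ (by positivity)
    linear_combination hE + (e * s.a - z * e' * s.c) * h
  -- Eliminating `C` from the pairing by the vanishing of the wave shows that `A` has the sign
  -- opposite to `B₁` and `B₂`.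
  have hI' : e * s.a * (e * t.a + -z * e' * t.c) =
      -(2 * z * (s.b₁ * t.b₂ + s.b₂ * t.b₁)) := by
    linear_combination e * t.a * h - z * e * e' * hI - 2 * z * (s.b₁ * t.b₂ + s.b₂ * t.b₁) * he
  have hab₁ : s.a * s.b₁ ≤ 0 := by
    have h3 : 0 ≤ -(s.a * s.b₁) * (e * (e * t.a + -z * e' * t.c)) := by
      have : -(s.a * s.b₁) * (e * (e * t.a + -z * e' * t.c)) =
        2 * z * (s.b₁ ^ 2 * t.b₂ + s.b₁ * s.b₂ * t.b₁) := by linear_combination -s.b₁ * hI'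
      rw [this]; positivity
    have := nonneg_of_mul_nonneg_left h3 (by positivity)
    linarith
  have hab₂ : s.a * s.b₂ ≤ 0 := by
    have h3 : 0 ≤ -(s.a * s.b₂) * (e * (e * t.a + -z * e' * t.c)) := by
      have : -(s.a * s.b₂) * (e * (e * t.a + -z * e' * t.c)) =
        2 * z * (s.b₁ * s.b₂ * t.b₂ + s.b₂ ^ 2 * t.b₁) := by linear_combination -s.b₂ * hI'
      rw [this]; positivity
    have := nonneg_of_mul_nonneg_left h3 (by positivity)
    linarith
  have h4 : 0 ≤ z * e' * (n k * 2 * -(s.a * s.b₁)) := by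
    have : 0 ≤ -(s.a * s.b₁) := by linarith
    positivity
  have h5 : 0 ≤ z * e' * (m k * 2 * -(s.a * s.b₂)) := by
    have : 0 ≤ -(s.a * s.b₂) := by linarith
    positivity
  linear_combination h4 + h5

end Sign

end TwoNovikov

end

/-! ### Interlacing roots from alternating signs -/

noncomputable section

namespace TwoNovikov

open Polynomial Filter

/-- A product whose first `i` factors are negative and whose other factors are positive has the
sign `(-1)^i`. -/
theorem sign_prod_pos {d : ℕ} (s : Finset (Fin d)) (f : Fin d → ℝ) (i : ℕ) (hi : i ≤ d)
    (hs : ∀ j ∉ s, i ≤ j.val) (hneg : ∀ j ∈ s, j.val < i → f j < 0)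
    (hpos : ∀ j ∈ s, i ≤ j.val → 0 < f j) :
    0 < (-1) ^ i * ∏ j ∈ s, f j := by
  have h1 : ((-1 : ℝ)) ^ i = ∏ j ∈ s, if j.val < i then (-1 : ℝ) else 1 := by
    rw [Finset.prod_ite, Finset.prod_const, Finset.prod_const_one, mul_one]
    congr 1
    have h2 : s.filter (fun j => j.val < i) = Finset.univ.filter (fun j : Fin d => j.val < i) := by
      ext j
      simp only [Finset.mem_filter, Finset.mem_univ, true_and, and_iff_right_iff_imp]
      intro hj
      by_contra h
      exact absurd (hs j h) (by omega)
    rw [h2, Fin.card_filter_val_lt, min_eq_right hi]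
  rw [h1, ← Finset.prod_mul_distrib]
  refine Finset.prod_pos fun j hj => ?_
  split_ifs with h
  · linarith [hneg j hj h]
  · linarith [hpos j hj (not_lt.1 h)]

theorem eventually_sign_eval {P : ℝ[X]} {d : ℕ} (hd : P.natDegree ≤ d)
    (hc : 0 < (-1) ^ d * P.coeff d) : ∀ᶠ t in atTop, 0 < (-1) ^ d * P.eval t := by
  have hne : P.coeff d ≠ 0 := fun h => by simp [h] at hc
  have hnd : P.natDegree = d := le_antisymm hd (le_natDegree_of_ne_zero hne)
  have hlc : (C ((-1 : ℝ) ^ d) * P).leadingCoeff = (-1) ^ d * P.coeff d := by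
    rw [leadingCoeff_mul, leadingCoeff_C, leadingCoeff, hnd]
  have heval : ∀ t, (-1) ^ d * P.eval t = (C ((-1 : ℝ) ^ d) * P).eval t := by simp
  simp only [heval]
  rcases Nat.eq_zero_or_pos d with rfl | hpos
  · rw [eq_C_of_natDegree_eq_zero hnd]
    refine Eventually.of_forall fun t => ?_
    simpa using hc
  · refine (tendsto_atTop_of_leadingCoeff_nonneg _ ?_ (hlc ▸ hc.le)).eventually_gt_atTop 0
    rw [← natDegree_pos_iff_degree_pos, natDegree_C_mul (by simp), hnd]
    exact hpos

/-- A polynomial of degree `d` whose signs alternate along `d` points and at infinity has `d`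
real roots, which interlace with these points. -/
theorem exists_interlacing_roots {P : ℝ[X]} {d : ℕ} (hd : P.natDegree ≤ d)
    (hc : 0 < (-1) ^ d * P.coeff d) {t : Fin d → ℝ} (ht : StrictMono t)
    (hP : ∀ j, 0 < (-1) ^ j.val * P.eval (t j)) :
    ∃ r : Fin d → ℝ, (∀ j, t j < r j) ∧ (∀ i j, i < j → r i < t j) ∧
      ∃ c : ℝ, 0 < c ∧ P = C c * ∏ j, (C (r j) - X) := by
  have key : ∀ j : Fin d, ∃ r, t j < r ∧ (∀ i, j < i → r < t i) ∧ P.eval r = 0 := by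
    intro j
    -- The right end of the bracket is the next sample point, or, after the last one, a point so
    -- large that the leading coefficient decides the sign.
    obtain ⟨T, hT, hTi, hs⟩ : ∃ T, t j < T ∧ (∀ i, j < i → T ≤ t i) ∧
        0 < (-1) ^ (j.val + 1) * P.eval T := by
      by_cases hj : j.val + 1 < d
      · exact ⟨t ⟨j.val + 1, hj⟩, ht (Fin.lt_def.2 (Nat.lt_succ_self _)),
          fun i hi => ht.monotone (Fin.le_def.2 hi), hP ⟨j.val + 1, hj⟩⟩
      · obtain ⟨T, h1, h2⟩ := ((eventually_sign_eval hd hc).and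
          (eventually_gt_atTop (t j))).exists
        have hjd : j.val + 1 = d := by omega
        exact ⟨T, h2, fun i hi => absurd (Fin.lt_def.1 hi) (by omega), by rwa [hjd]⟩
    have hcont : ContinuousOn (fun s => (-1) ^ j.val * P.eval s) (Set.Icc (t j) T) := by fun_prop
    obtain ⟨r, hr, hr0⟩ := intermediate_value_Ioo' hT.le hcont
      (show (0 : ℝ) ∈ Set.Ioo _ _ from ⟨by rw [pow_succ] at hs; linarith, hP j⟩)
    exact ⟨r, hr.1, fun i hi => hr.2.trans_le (hTi i hi), by simpa using hr0⟩
  choose r hr1 hr2 hr3 using key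
  have hmono : StrictMono r := fun i j hij => (hr2 i j hij).trans (hr1 j)
  refine ⟨r, hr1, fun i j => hr2 i j, (-1) ^ d * P.coeff d, hc, ?_⟩
  have hne : P.coeff d ≠ 0 := fun h => by simp [h] at hc
  have hnd : P.natDegree = d := le_antisymm hd (le_natDegree_of_ne_zero hne)
  have hP0 : P ≠ 0 := fun h => by simp [h] at hne
  have hprod : C ((-1) ^ d * P.coeff d) * ∏ j, (C (r j) - X) =
      C (P.coeff d) * ∏ j, (X - C (r j)) := by
    have : ∀ j, C (r j) - X = -1 * (X - C (r j)) := fun j => by ring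
    simp only [this, Finset.prod_mul_distrib, Finset.prod_const, Finset.card_univ,
      Fintype.card_fin, map_mul, map_pow, map_neg, map_one]
    rw [mul_mul_mul_comm, ← mul_pow]
    simp
  rw [hprod]
  have hdeg : (C (P.coeff d) * ∏ j, (X - C (r j))).degree = d := by
    rw [degree_C_mul hne, degree_prod]; simp
  refine Polynomial.eq_of_degree_le_of_eval_index_eq (s := Finset.univ) (v := r)
    hmono.injective.injOn ?_ ?_ ?_ ?_
  · simpa using degree_le_of_natDegree_le hd
  · rw [hdeg, degree_eq_natDegree hP0, hnd]
  · rw [leadingCoeff, hnd, leadingCoeff_mul, leadingCoeff_C, leadingCoeff_prod]; simp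
  · intro i _
    rw [hr3, eval_mul, eval_prod, Finset.prod_eq_zero (Finset.mem_univ i)] <;> simp

end TwoNovikov

end

/-! ### Degrees, leading signs, and the double interlacing induction -/

noncomputable section

namespace TwoNovikov

open Polynomial

variable {x m n : ℕ → ℝ}

theorem state_X_map (t : ℝ) (k : ℕ) :
    (state x m n (X : ℝ[X]) k).map (eval t) = state x m n t k := by
  have := state_map (aeval t : ℝ[X] →ₐ[ℝ] ℝ) x m n X k
  rw [aeval_X] at this
  rw [this]
  simp [State.map, coe_aeval_eq_eval]

theorem eval_state_a (t : ℝ) (k : ℕ) :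
    (state x m n (X : ℝ[X]) k).a.eval t = (state x m n t k).a :=
  congrArg State.a (state_X_map t k)

theorem eval_wave (t : ℝ) (k : ℕ) (y : ℝ) :
    ((state x m n (X : ℝ[X]) k).wave X y).eval t = (state x m n t k).wave t y := by
  have := State.wave_map (aeval t : ℝ[X] →ₐ[ℝ] ℝ) (state x m n X k) X y
  rw [← state_map, aeval_X] at this
  rw [this, coe_aeval_eq_eval]

theorem coeff_wave (s : State ℝ[X]) (y : ℝ) (j : ℕ) :
    (s.wave X y).coeff (j + 1) = Real.exp y * s.a.coeff (j + 1) + Real.exp (-y) * s.c.coeff j := by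
  simp only [State.wave, Polynomial.algebraMap_eq, coeff_add, coeff_C_mul, mul_assoc, coeff_X_mul]

theorem coeff_kick (s : State ℝ[X]) (y m n : ℝ) (j : ℕ) :
    (s.kick X y m n).coeff j = n * (2 * s.b₁.coeff j + m * (s.wave X y).coeff j) +
      m * (2 * s.b₂.coeff j + n * (s.wave X y).coeff j) := by
  have h2 : (2 : ℝ[X]) = C 2 := (map_ofNat C 2).symm
  simp only [State.kick, Polynomial.algebraMap_eq, coeff_add, coeff_C_mul, h2]

theorem coeff_jump_a (s : State ℝ[X]) (y m n : ℝ) (j : ℕ) :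
    (s.jump X y m n).a.coeff (j + 1) =
      s.a.coeff (j + 1) - Real.exp (-y) * (s.kick X y m n).coeff j := by
  simp only [State.jump, Polynomial.algebraMap_eq, coeff_sub, coeff_C_mul, mul_assoc, coeff_X_mul]

/-- Degree bounds: `deg A ≤ k`, and `deg 𝐁, deg C < k`. -/
theorem state_coeff_eq_zero (k : ℕ) :
    (∀ j, k < j → (state x m n (X : ℝ[X]) k).a.coeff j = 0) ∧
      ∀ j, k ≤ j → (state x m n (X : ℝ[X]) k).b₁.coeff j = 0 ∧
        (state x m n (X : ℝ[X]) k).b₂.coeff j = 0 ∧ (state x m n (X : ℝ[X]) k).c.coeff j = 0 := by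
  induction k with
  | zero =>
    refine ⟨fun j hj => ?_, fun j _ => by simp [state]⟩
    simp [state, coeff_one, hj.ne']
  | succ k ih =>
    obtain ⟨ha, hb⟩ := ih
    have hw : ∀ j, k < j → ((state x m n (X : ℝ[X]) k).wave X (x k)).coeff j = 0 := by
      intro j hj
      obtain ⟨i, rfl⟩ := Nat.exists_eq_succ_of_ne_zero (by omega : j ≠ 0)
      rw [Nat.succ_eq_add_one, coeff_wave, ha _ hj, (hb i (by omega)).2.2]
      simp
    have hk : ∀ j, k < j →
        ((state x m n (X : ℝ[X]) k).kick X (x k) (m k) (n k)).coeff j = 0 := by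
      intro j hj
      rw [coeff_kick, hw j hj, (hb j hj.le).1, (hb j hj.le).2.1]
      simp
    constructor
    · intro j hj
      obtain ⟨i, rfl⟩ := Nat.exists_eq_succ_of_ne_zero (by omega : j ≠ 0)
      rw [Nat.succ_eq_add_one, state, coeff_jump_a, ha _ (by omega), hk _ (by omega)]
      simp
    · intro j hj
      obtain ⟨h1, h2, h3⟩ := hb j (by omega)
      simp [state, State.jump, h1, h2, h3, hw j hj, hk j hj]

theorem coeff_kick_top (k : ℕ) :
    ((state x m n (X : ℝ[X]) k).kick X (x k) (m k) (n k)).coeff k =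
      2 * m k * n k * ((state x m n (X : ℝ[X]) k).wave X (x k)).coeff k := by
  obtain ⟨h1, h2, -⟩ := (state_coeff_eq_zero (x := x) (m := m) (n := n) k).2 k le_rfl
  rw [coeff_kick, h1, h2]
  ring

theorem coeff_a_top (k : ℕ) :
    (state x m n (X : ℝ[X]) (k + 1)).a.coeff (k + 1) =
      -(Real.exp (-x k) * ((state x m n (X : ℝ[X]) k).kick X (x k) (m k) (n k)).coeff k) := by
  rw [state, coeff_jump_a, (state_coeff_eq_zero k).1 _ (Nat.lt_succ_self k), zero_sub]

theorem coeff_c_top (k : ℕ) :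
    (state x m n (X : ℝ[X]) (k + 1)).c.coeff k =
      Real.exp (x k) * ((state x m n (X : ℝ[X]) k).kick X (x k) (m k) (n k)).coeff k := by
  simp [state, State.jump, ((state_coeff_eq_zero (x := x) (m := m) (n := n) k).2 k le_rfl).2.2]

/-- The top coefficient of `U_{k+1}` is that of the kick, hence a positive multiple of that of
`U_k`, times `e^{x_k - x_{k+1}} - e^{x_{k+1} - x_k} < 0`. The strict ordering of positions makes the
sign flip. -/
theorem wave_lead_sign (hx : StrictMono x) (hm : ∀ k, 0 < m k) (hn : ∀ k, 0 < n k) (k : ℕ) :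
    0 < (-1) ^ k * ((state x m n (X : ℝ[X]) k).wave X (x k)).coeff k := by
  induction k with
  | zero => simp [state, State.wave, Real.exp_pos]
  | succ k ih =>
    rw [coeff_wave, coeff_a_top, coeff_c_top, coeff_kick_top]
    have h1 : Real.exp (-x (k + 1)) * Real.exp (x k) < Real.exp (x (k + 1)) * Real.exp (-x k) := by
      rw [← Real.exp_add, ← Real.exp_add, Real.exp_lt_exp]
      linarith [hx (Nat.lt_succ_self k)]
    have h2 := mul_pos (mul_pos (mul_pos (hm k) (hn k)) (sub_pos.2 h1)) ih
    rw [pow_succ]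
    linear_combination 2 * h2

theorem a_lead_sign (hx : StrictMono x) (hm : ∀ k, 0 < m k) (hn : ∀ k, 0 < n k) (k : ℕ) :
    0 < (-1) ^ (k + 1) * (state x m n (X : ℝ[X]) (k + 1)).a.coeff (k + 1) := by
  rw [coeff_a_top, coeff_kick_top]
  have h2 := mul_pos (mul_pos (mul_pos (hm k) (hn k)) (Real.exp_pos (-x k)))
    (wave_lead_sign hx hm hn k)
  rw [pow_succ]
  linear_combination 2 * h2

theorem natDegree_a_le (k : ℕ) : (state x m n (X : ℝ[X]) k).a.natDegree ≤ k :=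
  natDegree_le_iff_coeff_eq_zero.2 fun j hj => (state_coeff_eq_zero k).1 j hj

theorem natDegree_wave_le (k : ℕ) :
    ((state x m n (X : ℝ[X]) k).wave X (x k)).natDegree ≤ k := by
  refine natDegree_le_iff_coeff_eq_zero.2 fun j hj => ?_
  obtain ⟨i, rfl⟩ := Nat.exists_eq_succ_of_ne_zero (by omega : j ≠ 0)
  obtain ⟨h1, h2⟩ := state_coeff_eq_zero (x := x) (m := m) (n := n) k
  rw [Nat.succ_eq_add_one, coeff_wave, h1 _ hj, (h2 i (by omega)).2.2]
  simp

theorem state_a_zero (k : ℕ) : (state x m n (0 : ℝ) k).a = 1 := by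
  induction k with
  | zero => simp [state]
  | succ k ih => simp [state, State.jump, ih]

/-- The zeros of `A` are positive and simple, and the signs of `C` alternate along them. -/
theorem exists_roots_a (hx : StrictMono x) (hm : ∀ k, 0 < m k) (hn : ∀ k, 0 < n k) (k : ℕ) :
    ∃ r : Fin k → ℝ, StrictMono r ∧ (∀ j, 0 < r j) ∧
      (∃ c : ℝ, 0 < c ∧ (state x m n (X : ℝ[X]) k).a = C c * ∏ j, (C (r j) - X)) ∧
      ∀ j : Fin k, 0 < (-1) ^ j.val * (state x m n (r j) k).c := by
  induction k with
  | zero =>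
    exact ⟨Fin.elim0, fun i => i.elim0, fun j => j.elim0, ⟨1, one_pos, by simp [state]⟩,
      fun j => j.elim0⟩
  | succ k ih =>
    obtain ⟨r, hr, hr0, ⟨c, hc, hA⟩, hC⟩ := ih
    have hev : ∀ t, (state x m n t k).a = c * ∏ j, (r j - t) := fun t => by
      rw [← eval_state_a, hA]; simp [eval_prod]
    have hAr : ∀ j, (state x m n (r j) k).a = 0 := fun j => by
      rw [hev, Finset.prod_eq_zero (Finset.mem_univ j) (by ring), mul_zero]
    obtain ⟨s, hrs, hsr, c', hc', hU⟩ := exists_interlacing_roots (natDegree_wave_le k)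
      (wave_lead_sign hx hm hn k) hr (fun j => by
        rw [eval_wave, State.wave, hAr, Algebra.algebraMap_self, RingHom.id_apply,
          RingHom.id_apply, mul_zero, zero_add]
        have := mul_pos (mul_pos (hr0 j) (Real.exp_pos (-x k))) (hC j)
        linear_combination this)
    have hUev : ∀ t, (state x m n t k).wave t (x k) = c' * ∏ j, (s j - t) := fun t => by
      rw [← eval_wave, hU]; simp [eval_prod]
    have hs : StrictMono s := fun i j hij => (hsr i j hij).trans (hrs j)
    have hs0 : ∀ j, 0 < s j := fun j => (hr0 j).trans (hrs j)
    have hAs : ∀ j : Fin k, 0 < (-1) ^ (j.val + 1) * (state x m n (s j) (k + 1)).a := by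
      intro j
      have h1 : (state x m n (s j) k).wave (s j) (x k) = 0 := by
        rw [hUev, Finset.prod_eq_zero (Finset.mem_univ j) (by ring), mul_zero]
      have h2 : 0 < (-1) ^ (j.val + 1) * (state x m n (s j) k).a := by
        have := sign_prod_pos Finset.univ (fun i => r i - s j) (j.val + 1) (by omega)
          (by simp) (fun i _ hi => sub_neg.2 <|
            (hr.monotone (Fin.le_def.2 (Nat.lt_succ_iff.1 hi))).trans_lt (hrs j))
          (fun i _ hi => sub_pos.2 (hsr j i (Fin.lt_def.2 hi)))
        rw [hev]
        linear_combination c * this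
      have h3 := sq_a_le_of_wave_eq_zero hx hm hn (hs0 j) h1
      have h4 : (state x m n (s j) k).a ≠ 0 := fun h => by simp [h] at h2
      have h5 : 0 < (state x m n (s j) k).a * (state x m n (s j) (k + 1)).a :=
        (by positivity : 0 < (state x m n (s j) k).a ^ 2).trans_le h3
      refine pos_of_mul_pos_right (a := (-1) ^ (j.val + 1) * (state x m n (s j) k).a) ?_ h2.le
      rw [mul_mul_mul_comm, ← mul_pow]
      simpa using h5
    -- The `k` zeros of `U_k` give too few sample points for degree `k + 1`; the missing one is `0`,
    -- where `A = 1`.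
    obtain ⟨y, hty, hyt, c'', hc'', hA'⟩ := exists_interlacing_roots
      (P := (state x m n (X : ℝ[X]) (k + 1)).a) (natDegree_a_le (k + 1)) (a_lead_sign hx hm hn k)
      (t := Fin.cons 0 s) (by
        refine Fin.strictMono_iff_lt_succ.2 fun i => ?_
        rw [Fin.cons_succ]
        rcases Fin.eq_zero_or_eq_succ i.castSucc with h | ⟨j, h⟩
        · rw [h, Fin.cons_zero]; exact hs0 i
        · rw [h, Fin.cons_succ]
          refine hs (Fin.lt_def.2 ?_)
          have := congrArg Fin.val h
          simp only [Fin.val_castSucc, Fin.val_succ] at this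
          omega)
      (fun j => by
        rw [eval_state_a]
        refine Fin.cases ?_ (fun i => ?_) j
        · simp [state_a_zero]
        · simpa using hAs i)
    have hy : StrictMono y := fun i j hij => (hyt i j hij).trans (hty j)
    have hy0 : ∀ j, 0 < y j := fun j =>
      ((hty 0).trans_le (hy.monotone (Fin.zero_le j)))
    refine ⟨y, hy, hy0, ⟨c'', hc'', hA'⟩, fun j => ?_⟩
    have hAy : (state x m n (y j) (k + 1)).a = 0 := by
      rw [← eval_state_a, hA', eval_mul, eval_prod, Finset.prod_eq_zero (Finset.mem_univ j)] <;>
        simp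
    -- Since `A` vanishes here, continuity of the wave across the jump expresses `C_{k+1}` through
    -- the factored `U_k`.
    have hw : y j * Real.exp (-x k) * (state x m n (y j) (k + 1)).c =
        c' * ∏ i, (s i - y j) := by
      rw [← hUev, ← State.wave_jump _ _ _ (m k) (n k), ← state, wave_real, hAy]
      ring
    have hsgn := sign_prod_pos Finset.univ (fun i => s i - y j) j.val (by omega) (by simp)
      (fun i _ hi => by
        have h1 : s i = (Fin.cons 0 s : Fin (k + 1) → ℝ) i.succ := by simp
        have h2 : s i < y i.succ := by simpa using hty i.succ
        exact sub_neg.2 (h2.trans_le (hy.monotone (Fin.le_def.2 (by simpa using hi)))))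
      (fun i _ hi => by
        have := hyt j i.succ (Fin.lt_def.2 (by simp; omega))
        rw [Fin.cons_succ] at this
        exact sub_pos.2 this)
    refine pos_of_mul_pos_right (a := y j * Real.exp (-x k)) ?_
      (mul_pos (hy0 j) (Real.exp_pos _)).le
    have := mul_pos hc' hsgn
    linear_combination this - (-1) ^ j.val * hw

end TwoNovikov

end

/-! ### The eigenvalue problem as a boundary value problem for the jump recursion -/

noncomputable section

namespace TwoNovikov

/-- Every strictly increasing finite sequence of reals extends to an infinite one. -/
theorem exists_strictMono_extension {N : ℕ} {x : Fin N → ℝ} (hx : StrictMono x) :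
    ∃ y : ℕ → ℝ, StrictMono y ∧ x = fun i : Fin N => y i := by
  rcases N with _ | N
  · exact ⟨fun k => k, fun i j h => Nat.cast_lt.2 h, funext fun i => i.elim0⟩
  · refine ⟨fun k => if h : k < N + 1 then x ⟨k, h⟩ else x (Fin.last N) + k,
      strictMono_nat_of_lt_succ fun k => ?_, funext fun i => by dsimp only; rw [dif_pos i.isLt]⟩
    by_cases h : k + 1 < N + 1
    · rw [dif_pos h, dif_pos (by omega)]
      exact hx (Fin.lt_def.2 (Nat.lt_succ_self k))
    · rw [dif_neg h]
      split_ifs with h'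
      · have : (⟨k, h'⟩ : Fin (N + 1)) = Fin.last N := Fin.ext (by simp; omega)
        rw [this]
        have : (0 : ℝ) < (k + 1 : ℕ) := by positivity
        linarith
      · push_cast; linarith

theorem exists_pos_extension {N : ℕ} {m : Fin N → ℝ} (hm : ∀ j, 0 < m j) :
    ∃ y : ℕ → ℝ, (∀ k, 0 < y k) ∧ m = fun i : Fin N => y i := by
  refine ⟨fun k => if h : k < N then m ⟨k, h⟩ else 1, fun k => ?_, funext fun i => by simp⟩
  dsimp only
  split_ifs with h
  · exact hm _
  · exact one_pos

variable (x m n : ℕ → ℝ)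

theorem coeffs_eq_state {N : ℕ} (z : ℂ) {k : ℕ} (hk : k ≤ N) :
    coeffs (N := N) (fun i => x i) (fun i => m i) (fun i => n i) z k =
      ![(state x m n z k).a, (state x m n z k).b₁, (state x m n z k).b₂, (state x m n z k).c] := by
  induction k with
  | zero => simp [coeffs, state]
  | succ k ih =>
    have he : ((Real.exp (x k) : ℝ) : ℂ) * ((Real.exp (-x k) : ℝ) : ℂ) = 1 := by
      rw [← Complex.ofReal_mul, ← Real.exp_add]; simp
    rw [coeffs, dif_pos (by omega : k < N), ih (by omega), state]
    generalize state x m n z k = s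
    simp only [transition, form, vec, dualVec, State.jump, State.kick, State.wave,
      Complex.coe_algebraMap]
    generalize ((Real.exp (x k) : ℝ) : ℂ) = e at *
    generalize ((Real.exp (-x k) : ℝ) : ℂ) = e' at *
    ext i
    fin_cases i
    · simp [Matrix.mulVec, dotProduct, Fin.sum_univ_four]
      linear_combination 2 * z * m k * n k * s.a * he
    · simp [Matrix.mulVec, dotProduct, Fin.sum_univ_four]
      ring
    · simp [Matrix.mulVec, dotProduct, Fin.sum_univ_four]
      ring
    · simp [Matrix.mulVec, dotProduct, Fin.sum_univ_four]
      linear_combination -2 * z * m k * n k * s.c * he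

/-- The convolution of a finite sequence with the kernel `exp (-|x_k - x_l|)`, split at `k`. -/
def green (N : ℕ) (h : ℕ → ℂ) (k : ℕ) : ℂ :=
  (Real.exp (x k) : ℝ) * ∑ l ∈ Finset.Ico k N, ((Real.exp (-x l) : ℝ) : ℂ) * h l +
    (Real.exp (-x k) : ℝ) * ∑ l ∈ Finset.range k, ((Real.exp (x l) : ℝ) : ℂ) * h l

theorem sum_matE_mul {x : ℕ → ℝ} (hx : StrictMono x) {N : ℕ} (h : ℕ → ℂ) (k : Fin N) :
    ∑ l : Fin N, ((matE (fun i : Fin N => x i) k l : ℝ) : ℂ) * h l = green x N h k := by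
  rw [green, Finset.mul_sum, Finset.mul_sum, add_comm]
  refine (Fin.sum_univ_eq_sum_range
    (fun l => ((Real.exp (-|x k - x l|) : ℝ) : ℂ) * h l) N).trans ?_
  rw [Finset.range_eq_Ico, ← Finset.sum_Ico_consecutive _ (Nat.zero_le k.val) k.isLt.le, Finset.range_eq_Ico]
  congr 1
  · refine Finset.sum_congr rfl fun l hl => ?_
    have := hx (Finset.mem_Ico.1 hl).2
    rw [abs_of_pos (by linarith), ← mul_assoc, ← Complex.ofReal_mul, ← Real.exp_add]
    ring_nf
  · refine Finset.sum_congr rfl fun l hl => ?_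
    have := hx.monotone (Finset.mem_Ico.1 hl).1
    rw [abs_of_nonpos (by linarith), ← mul_assoc, ← Complex.ofReal_mul, ← Real.exp_add]
    ring_nf

/-- The weights `1` on and `2` below the diagonal add the partial sums before and after site `i`;
this is where `𝐁_k + 𝐁_{k+1}` comes from. -/
theorem sum_matT_mul {N : ℕ} (f : ℕ → ℂ) (i : Fin N) :
    ∑ j : Fin N, ((matT N i j : ℝ) : ℂ) * f j =
      ∑ j ∈ Finset.range i, f j + ∑ j ∈ Finset.range (i + 1), f j := by
  have h1 : ∀ j : Fin N, ((matT N i j : ℝ) : ℂ) * f j =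
      (if j.val < i.val then f j else 0) + (if j.val < i.val + 1 then f j else 0) := by
    intro j
    simp only [matT, Matrix.of_apply, Fin.ext_iff, Fin.lt_def]
    rcases lt_trichotomy i.val j.val with h | h | h
    · rw [if_neg h.ne, if_neg (by omega), if_neg (by omega), if_neg (by omega)]; simp
    · rw [if_pos h, if_neg (by omega), if_pos (by omega)]; simp
    · rw [if_neg h.ne', if_pos h, if_pos h, if_pos (by omega)]; push_cast; ring
  have h2 : ∀ k, k ≤ N → ∑ j : Fin N, (if j.val < k then f j else 0) =
      ∑ j ∈ Finset.range k, f j := by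
    intro k hk
    rw [Fin.sum_univ_eq_sum_range (fun j => if j < k then f j else 0) N, ← Finset.sum_filter]
    congr 1
    ext j
    simp only [Finset.mem_filter, Finset.mem_range]
    omega
  simp only [h1, Finset.sum_add_distrib]
  rw [h2 _ i.isLt.le, h2 _ i.isLt]

theorem spectralMatrix_mulVec {N : ℕ} (x m n : Fin N → ℝ) (Ψ : Fin N × Fin 2 → ℂ) (i : Fin N)
    (a : Fin 2) :
    ((spectralMatrix x m n).map (fun r : ℝ => (r : ℂ)) *ᵥ Ψ) (i, a) =
      ∑ j, ((matT N i j : ℝ) : ℂ) * ((vec m n j a : ℝ) *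
        ∑ l, ((matE x j l : ℝ) : ℂ) * (n l * Ψ (l, 0) + m l * Ψ (l, 1))) := by
  have hmap : ∀ {α β γ : Type} [Fintype β] (A : Matrix α β ℝ) (B : Matrix β γ ℝ),
      (A * B).map (fun r : ℝ => (r : ℂ)) =
        A.map (fun r : ℝ => (r : ℂ)) * B.map (fun r : ℝ => (r : ℂ)) := by
    intro α β γ _ A B
    exact Matrix.map_mul (f := Complex.ofRealHom)
  rw [spectralMatrix, hmap, hmap, hmap, ← Matrix.mulVec_mulVec, ← Matrix.mulVec_mulVec,
    ← Matrix.mulVec_mulVec]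
  have h1 : ∀ l, ((matPstar m n).map (fun r : ℝ => (r : ℂ)) *ᵥ Ψ) l =
      n l * Ψ (l, 0) + m l * Ψ (l, 1) := by
    intro l
    simp [Matrix.mulVec, dotProduct, Fintype.sum_prod_type, matPstar, dualVec, apply_ite,
      ite_mul]
  have h2 : ∀ (v : Fin N → ℂ) (ja : Fin N × Fin 2),
      ((matP m n).map (fun r : ℝ => (r : ℂ)) *ᵥ v) ja = (vec m n ja.1 ja.2 : ℝ) * v ja.1 := by
    intro v ja
    simp [Matrix.mulVec, dotProduct, matP, apply_ite, ite_mul]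
  have h3 : ∀ (v : Fin N × Fin 2 → ℂ),
      ((matT N ⊗ₖ (1 : Matrix (Fin 2) (Fin 2) ℝ)).map (fun r : ℝ => (r : ℂ)) *ᵥ v) (i, a) =
        ∑ j, ((matT N i j : ℝ) : ℂ) * v (j, a) := by
    intro v
    simp [Matrix.mulVec, dotProduct, Fintype.sum_prod_type, Matrix.kroneckerMap_apply,
      Matrix.one_apply, apply_ite, ite_mul]
  rw [h3]
  refine Finset.sum_congr rfl fun j _ => ?_
  rw [h2]
  congr 2
  simp only [Matrix.mulVec, dotProduct]
  refine Finset.sum_congr rfl fun l _ => ?_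
  rw [← h1 l]
  rfl

theorem mem_spectrumSet_iff {x : ℕ → ℝ} (hx : StrictMono x) (m n : ℕ → ℝ) (N : ℕ) (z : ℂ) :
    z ∈ spectrumSet (N := N) (fun i => x i) (fun i => m i) (fun i => n i) ↔
      ∃ p q : ℕ → ℂ, (∃ k < N, p k ≠ 0 ∨ q k ≠ 0) ∧ ∀ k < N,
        (p k = z * (∑ j ∈ Finset.range k, m j * green x N (fun l => n l * p l + m l * q l) j +
          ∑ j ∈ Finset.range (k + 1), m j * green x N (fun l => n l * p l + m l * q l) j)) ∧
        (q k = z * (∑ j ∈ Finset.range k, n j * green x N (fun l => n l * p l + m l * q l) j +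
          ∑ j ∈ Finset.range (k + 1), n j * green x N (fun l => n l * p l + m l * q l) j)) := by
  have key : ∀ (p q : ℕ → ℂ) (Ψ : Fin N × Fin 2 → ℂ), (∀ i, Ψ (i, 0) = p i) →
      (∀ i, Ψ (i, 1) = q i) → ∀ i : Fin N,
      ((spectralMatrix (fun i : Fin N => x i) (fun i => m i) (fun i => n i)).map
        (fun r : ℝ => (r : ℂ)) *ᵥ Ψ) (i, 0) =
        (∑ j ∈ Finset.range i, m j * green x N (fun l => n l * p l + m l * q l) j +
          ∑ j ∈ Finset.range (i + 1), m j * green x N (fun l => n l * p l + m l * q l) j) ∧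
      ((spectralMatrix (fun i : Fin N => x i) (fun i => m i) (fun i => n i)).map
        (fun r : ℝ => (r : ℂ)) *ᵥ Ψ) (i, 1) =
        (∑ j ∈ Finset.range i, n j * green x N (fun l => n l * p l + m l * q l) j +
          ∑ j ∈ Finset.range (i + 1), n j * green x N (fun l => n l * p l + m l * q l) j) := by
    intro p q Ψ hp hq i
    simp only [spectralMatrix_mulVec, hp, hq, ← sum_matT_mul]
    have := sum_matE_mul hx (N := N) (fun l => n l * p l + m l * q l)
    simp only [this]
    simp [vec]
  constructor
  · rintro ⟨Ψ, hΨ, h⟩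
    refine ⟨fun k => if hk : k < N then Ψ (⟨k, hk⟩, 0) else 0,
      fun k => if hk : k < N then Ψ (⟨k, hk⟩, 1) else 0, ?_, fun k hk => ?_⟩
    · by_contra! hcon
      refine hΨ (funext fun ⟨i, a⟩ => ?_)
      have := hcon i i.isLt
      simp only [i.isLt, dif_pos] at this
      fin_cases a
      · exact this.1
      · exact this.2
    · have h0 := congrFun h (⟨k, hk⟩, 0)
      have h1 := congrFun h (⟨k, hk⟩, 1)
      obtain ⟨h2, h3⟩ := key (fun k => if hk : k < N then Ψ (⟨k, hk⟩, 0) else 0)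
        (fun k => if hk : k < N then Ψ (⟨k, hk⟩, 1) else 0) Ψ (by simp) (by simp) ⟨k, hk⟩
      rw [Pi.smul_apply, smul_eq_mul, h2] at h0
      rw [Pi.smul_apply, smul_eq_mul, h3] at h1
      exact ⟨(dif_pos hk).trans h0, (dif_pos hk).trans h1⟩
  · rintro ⟨p, q, ⟨k, hk, hne⟩, h⟩
    have hkey := key p q (fun ia => if ia.2 = 0 then p ia.1 else q ia.1) (by simp) (by simp)
    refine ⟨fun ia => if ia.2 = 0 then p ia.1 else q ia.1, fun h0 => ?_, funext fun ⟨i, a⟩ => ?_⟩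
    · have h1 := congrFun h0 (⟨k, hk⟩, 0)
      have h2 := congrFun h0 (⟨k, hk⟩, 1)
      simp at h1 h2
      exact hne.elim (fun h => h h1) (fun h => h h2)
    · rw [Pi.smul_apply, smul_eq_mul]
      fin_cases a
      · refine Eq.trans ?_ (congrArg (z * ·) (hkey i).1.symm)
        simpa using (h i i.isLt).1
      · refine Eq.trans ?_ (congrArg (z * ·) (hkey i).2.symm)
        simpa using (h i i.isLt).2

/-- The transition is linear in the coefficient vector. -/
theorem eq_smul_state {s : ℕ → State ℂ} {z : ℂ} {N : ℕ} (h0 : (s 0).b₁ = 0 ∧ (s 0).b₂ = 0 ∧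
    (s 0).c = 0) (h : ∀ k < N, s (k + 1) = (s k).jump z (x k) (m k) (n k)) {k : ℕ} (hk : k ≤ N) :
    s k = (state x m n z k).map ((s 0).a * ·) := by
  induction k with
  | zero => ext <;> simp [state, State.map, h0]
  | succ k ih =>
    rw [h k hk, ih (by omega), state]
    ext <;> simp only [State.jump, State.kick, State.wave, State.map] <;> ring

variable {x}

/-- The points `z` with `Ψ = z M Ψ`, `Ψ ≠ 0`, are the zeros of `A`. -/
theorem mem_spectrumSet_iff_state_a (hx : StrictMono x) (N : ℕ) (z : ℂ) :
    z ∈ spectrumSet (N := N) (fun i => x i) (fun i => m i) (fun i => n i) ↔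
      (state x m n z N).a = 0 := by
  have he : ∀ k, ((Real.exp (x k) : ℝ) : ℂ) * ((Real.exp (-x k) : ℝ) : ℂ) = 1 := fun k => by
    rw [← Complex.ofReal_mul, ← Real.exp_add]; simp
  rw [mem_spectrumSet_iff hx]
  constructor
  · rintro ⟨p, q, ⟨k, hk, hne⟩, h⟩
    have hz : z ≠ 0 := by
      rintro rfl
      have := h k hk
      simp only [zero_mul] at this
      exact hne.elim (fun h => h this.1) (fun h => h this.2)
    set f : ℕ → ℂ := fun l => n l * p l + m l * q l with hf
    -- The two halves of the Green sum serve as `A` and `z C`. With `A` the tail sum, `A = 0` at `N`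
    -- is automatic; the other entries start from `0`, so `s` is a multiple of `state`.
    let s : ℕ → State ℂ := fun k =>
      ⟨∑ l ∈ Finset.Ico k N, ((Real.exp (-x l) : ℝ) : ℂ) * f l,
        ∑ j ∈ Finset.range k, m j * green x N f j, ∑ j ∈ Finset.range k, n j * green x N f j,
        z⁻¹ * ∑ l ∈ Finset.range k, ((Real.exp (x l) : ℝ) : ℂ) * f l⟩
    have hwave : ∀ k, (s k).wave z (x k) = green x N f k := by
      intro k
      simp only [s, State.wave, green, Complex.coe_algebraMap]
      field_simp
    have hkick : ∀ k < N, z * (s k).kick z (x k) (m k) (n k) = f k := by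
      intro k hk
      obtain ⟨h1, h2⟩ := h k hk
      rw [State.kick, hwave, hf]
      simp only [h1, h2, Finset.sum_range_succ, s, Complex.coe_algebraMap]
      ring
    have hs : ∀ k < N, s (k + 1) = (s k).jump z (x k) (m k) (n k) := by
      intro k hk
      ext
      · simp only [State.jump, Complex.coe_algebraMap]
        rw [show z * ((Real.exp (-x k) : ℝ) : ℂ) * (s k).kick z (x k) (m k) (n k) =
          (Real.exp (-x k) : ℝ) * f k by rw [← hkick k hk]; ring]
        simp only [s]
        rw [Finset.sum_eq_sum_Ico_succ_bot hk]
        ring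
      · simp only [State.jump, hwave, Complex.coe_algebraMap]
        simp only [s, Finset.sum_range_succ]
      · simp only [State.jump, hwave, Complex.coe_algebraMap]
        simp only [s, Finset.sum_range_succ]
      · simp only [State.jump, Complex.coe_algebraMap]
        rw [show (s k).kick z (x k) (m k) (n k) = z⁻¹ * f k by
          rw [← hkick k hk]; field_simp]
        simp only [s, Finset.sum_range_succ]
        ring
    have hlin : ∀ k ≤ N, s k = (state x m n z k).map ((s 0).a * ·) := fun k hk =>
      eq_smul_state x m n (by simp [s]) hs hk
    have hN : (s N).a = 0 := by simp [s]
    rw [hlin N le_rfl] at hN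
    -- If the multiple were `0`, both components of `𝐁` would vanish throughout, and with them the
    -- eigenvector.
    refine (mul_eq_zero.1 hN).resolve_left fun h0 => ?_
    have hb₁ : ∀ k ≤ N, ∑ j ∈ Finset.range k, m j * green x N f j = 0 := fun k hk =>
      (congrArg State.b₁ (hlin k hk)).trans (by simp [State.map, h0])
    have hb₂ : ∀ k ≤ N, ∑ j ∈ Finset.range k, n j * green x N f j = 0 := fun k hk =>
      (congrArg State.b₂ (hlin k hk)).trans (by simp [State.map, h0])
    obtain ⟨h1, h2⟩ := h k hk
    rw [hb₁ k hk.le, hb₁ (k + 1) hk] at h1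
    rw [hb₂ k hk.le, hb₂ (k + 1) hk] at h2
    simp only [add_zero, mul_zero] at h1 h2
    exact hne.elim (fun h => h h1) (fun h => h h2)
  · intro hA
    set s : ℕ → State ℂ := state x m n z with hs
    have hjump : ∀ k, s (k + 1) = (s k).jump z (x k) (m k) (n k) := fun k => rfl
    set p : ℕ → ℂ := fun k => z * ((s k).b₁ + (s (k + 1)).b₁) with hp
    set q : ℕ → ℂ := fun k => z * ((s k).b₂ + (s (k + 1)).b₂) with hq
    have hf : ∀ l, n l * p l + m l * q l = z * (s l).kick z (x l) (m l) (n l) := by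
      intro l
      simp only [hp, hq, hjump, State.jump, State.kick, Complex.coe_algebraMap]
      ring
    have ha : ∀ k, ∑ l ∈ Finset.range k, ((Real.exp (-x l) : ℝ) : ℂ) *
        (n l * p l + m l * q l) = 1 - (s k).a := by
      intro k
      induction k with
      | zero => simp [hs, state]
      | succ k ih =>
        rw [Finset.sum_range_succ, ih, hf, hjump]
        simp only [State.jump, Complex.coe_algebraMap]
        ring
    have hc : ∀ k, ∑ l ∈ Finset.range k, ((Real.exp (x l) : ℝ) : ℂ) *
        (n l * p l + m l * q l) = z * (s k).c := by
      intro k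
      induction k with
      | zero => simp [hs, state]
      | succ k ih =>
        rw [Finset.sum_range_succ, ih, hf, hjump]
        simp only [State.jump, Complex.coe_algebraMap]
        ring
    have hgreen : ∀ k ≤ N, green x N (fun l => n l * p l + m l * q l) k =
        (s k).wave z (x k) := by
      intro k hk
      rw [green, hc, Finset.sum_Ico_eq_sub _ hk, ha, ha, hA]
      simp only [State.wave, Complex.coe_algebraMap]
      ring
    have hb₁ : ∀ k ≤ N, ∑ j ∈ Finset.range k,
        m j * green x N (fun l => n l * p l + m l * q l) j = (s k).b₁ := by
      intro k hk
      induction k with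
      | zero => simp [hs, state]
      | succ k ih => rw [Finset.sum_range_succ, ih (by omega), hgreen k (by omega), hjump]; rfl
    have hb₂ : ∀ k ≤ N, ∑ j ∈ Finset.range k,
        n j * green x N (fun l => n l * p l + m l * q l) j = (s k).b₂ := by
      intro k hk
      induction k with
      | zero => simp [hs, state]
      | succ k ih => rw [Finset.sum_range_succ, ih (by omega), hgreen k (by omega), hjump]; rfl
    refine ⟨p, q, ?_, fun k hk => ?_⟩
    -- The weighted sum of the eigenvector over all sites is `1 - A_N = 1`, so it cannot vanish.
    · by_contra! hcon
      have h1 := ha N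
      rw [hA, Finset.sum_eq_zero] at h1
      · simp at h1
      · intro l hl
        obtain ⟨h2, h3⟩ := hcon l (Finset.mem_range.1 hl)
        rw [h2, h3]; simp
    · rw [hb₁ k hk.le, hb₁ (k + 1) hk, hb₂ k hk.le, hb₂ (k + 1) hk]
      exact ⟨rfl, rfl⟩

end TwoNovikov

end

/-! ### Residues of the Weyl function -/

noncomputable section

namespace TwoNovikov

open Polynomial

theorem hasSimpleResidue_of_eq_div {f φ : ℂ → Fin 2 → ℂ} {p : ℂ} (hφ : AnalyticAt ℂ φ p)
    (h : ∀ᶠ z in 𝓝[≠] p, f z = (z - p)⁻¹ • φ z) : HasSimpleResidue f p (φ p) := by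
  obtain ⟨q, hq⟩ := hφ
  -- The regular part is the difference quotient of `φ`, extended analytically across `p`.
  refine ⟨dslope φ p, ⟨_, hq.has_fpower_series_dslope_fslope⟩, ?_⟩
  filter_upwards [h, self_mem_nhdsWithin] with z hz hne
  rw [hz, dslope_of_ne _ hne, slope_def_module, smul_sub, add_sub_cancel]

variable (x m n : ℕ → ℝ)

theorem state_X_map_complex (z : ℂ) (k : ℕ) :
    (state x m n (X : ℝ[X]) k).map (aeval z) = state x m n z k := by
  have := state_map (aeval z : ℝ[X] →ₐ[ℝ] ℂ) x m n X k
  rw [aeval_X] at this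
  exact this.symm

theorem state_ofReal (t : ℝ) (k : ℕ) :
    state x m n (t : ℂ) k = (state x m n t k).map (fun s : ℝ => (s : ℂ)) :=
  state_map Complex.ofRealAm x m n t k

theorem differentiable_state_b (k : ℕ) :
    Differentiable ℂ (fun z : ℂ => (![(state x m n z k).b₁, (state x m n z k).b₂] :
      Fin 2 → ℂ)) := by
  refine differentiable_pi.2 fun a => ?_
  fin_cases a
  · have : (fun z : ℂ => (state x m n z k).b₁) =
        fun z => aeval z (state x m n (X : ℝ[X]) k).b₁ :=
      funext fun z => (congrArg State.b₁ (state_X_map_complex x m n z k)).symm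
    change Differentiable ℂ (fun z : ℂ => (state x m n z k).b₁)
    rw [this]
    exact Polynomial.differentiable_aeval _
  · have : (fun z : ℂ => (state x m n z k).b₂) =
        fun z => aeval z (state x m n (X : ℝ[X]) k).b₂ :=
      funext fun z => (congrArg State.b₂ (state_X_map_complex x m n z k)).symm
    change Differentiable ℂ (fun z : ℂ => (state x m n z k).b₂)
    rw [this]
    exact Polynomial.differentiable_aeval _

variable {x m n}

theorem residue_weylW (hx : StrictMono x) (hm : ∀ k, 0 < m k) (hn : ∀ k, 0 < n k) {N : ℕ}
    {r : Fin N → ℝ} (hr : StrictMono r) (hr0 : ∀ j, 0 < r j) {c : ℝ} (hc : 0 < c)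
    (hA : (state x m n (X : ℝ[X]) N).a = C c * ∏ j, (C (r j) - X))
    (hC : ∀ j : Fin N, 0 < (-1) ^ j.val * (state x m n (r j) N).c) (j : Fin N) :
    ∃ b : Fin 2 → ℝ, (∀ a, 0 < b a) ∧
      HasSimpleResidue (weylW (N := N) (fun i => x i) (fun i => m i) (fun i => n i)) (r j : ℂ)
        (fun a => (b a : ℂ)) := by
  have hAz : ∀ z : ℂ, (state x m n z N).a =
      (r j - z) * (c * ∏ i ∈ Finset.univ.erase j, ((r i : ℂ) - z)) := by
    intro z
    have h := congrArg State.a (state_X_map_complex x m n z N)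
    rw [← h, State.map, hA, ← Finset.mul_prod_erase _ _ (Finset.mem_univ j)]
    simp [map_prod]
    ring
  set Q : ℂ → ℂ := fun z => c * ∏ i ∈ Finset.univ.erase j, ((r i : ℂ) - z) with hQ
  set q : ℝ := c * ∏ i ∈ Finset.univ.erase j, (r i - r j) with hq
  have hQq : Q (r j) = q := by simp [hQ, hq]
  have hq0 : 0 < (-1) ^ j.val * q := by
    have := mul_pos hc (sign_prod_pos (Finset.univ.erase j) (fun i => r i - r j) j.val
      j.isLt.le (fun i hi => by
        have : i = j := by simpa using hi
        rw [this])
      (fun i _ hi => sub_neg.2 (hr (Fin.lt_def.2 hi)))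
      (fun i hi hij => sub_pos.2 (hr (lt_of_le_of_ne (Fin.le_def.2 hij)
        (Finset.ne_of_mem_erase hi).symm))))
    rw [hq]
    linear_combination this
  have hqne : q ≠ 0 := fun h => by simp [h] at hq0
  have ha0 : (state x m n (r j) N).a = 0 := by
    have h := hAz (r j)
    rw [state_ofReal, sub_self, zero_mul] at h
    exact Complex.ofReal_eq_zero.1 h
  obtain ⟨k, rfl⟩ := Nat.exists_eq_succ_of_ne_zero (by have := j.isLt; omega : N ≠ 0)
  obtain ⟨h1, h2⟩ := c_mul_b_pos hx hm hn (hr0 j) ha0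
  have hCj := hC j
  have sgn : ∀ b : ℝ, 0 < (state x m n (r j) (k + 1)).c * b → 0 < q⁻¹ * b := by
    intro b hb
    have hsq : ((-1 : ℝ) ^ j.val) * (-1) ^ j.val = 1 := by rw [← mul_pow]; simp
    have h3 : 0 < (-1) ^ j.val * b := by
      refine pos_of_mul_pos_right
        (a := (-1) ^ j.val * (state x m n (r j) (k + 1)).c) ?_ hCj.le
      rw [mul_mul_mul_comm, hsq, one_mul]
      exact hb
    have h4 := div_pos h3 hq0
    rwa [mul_div_mul_left _ _ (by simp), div_eq_inv_mul] at h4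
  refine ⟨![q⁻¹ * (state x m n (r j) (k + 1)).b₁, q⁻¹ * (state x m n (r j) (k + 1)).b₂],
    fun a => ?_, ?_⟩
  · fin_cases a
    · exact sgn _ h1
    · exact sgn _ h2
  · set φ : ℂ → Fin 2 → ℂ := fun z =>
      (Q z)⁻¹ • ![(state x m n z (k + 1)).b₁, (state x m n z (k + 1)).b₂] with hφ
    have hval : (fun a => ((![q⁻¹ * (state x m n (r j) (k + 1)).b₁,
        q⁻¹ * (state x m n (r j) (k + 1)).b₂] a : ℝ) : ℂ)) = φ (r j) := by
      rw [hφ]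
      ext a
      simp only [hQq, state_ofReal]
      fin_cases a <;> simp [State.map]
    rw [hval]
    refine hasSimpleResidue_of_eq_div ?_ ?_
    · have hQd : Differentiable ℂ Q := by
        simp only [hQ]
        fun_prop
      refine AnalyticAt.smul ((hQd.analyticAt _).inv ?_) ((differentiable_state_b x m n _).analyticAt _)
      rw [hQq]
      exact_mod_cast hqne
    · filter_upwards with z
      simp only [weylW, coeffA, coeffB, coeffs_eq_state x m n z le_rfl, hφ]
      simp only [Matrix.cons_val_zero, Matrix.cons_val_one, Matrix.cons_val, Nat.succ_eq_add_one]
      -- The minus sign of the Weyl function turns `r j - z` into `z - r j`, so the residue is `𝐁 /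
      -- Q` at `r j`.
      rw [hAz, mul_inv, smul_smul, ← neg_smul, ← neg_mul, ← inv_neg, neg_sub]

end TwoNovikov

end

theorem mainTheorem5 (N : ℕ) (x m n : Fin N → ℝ) (h : TwoNovikov.PurePeakon x m n) :
    ∃ lam : Fin N → ℝ, StrictAnti lam ∧ (∀ j, 0 < lam j) ∧
      TwoNovikov.spectrumSet x m n = Set.range (fun j => (lam j : ℂ)) ∧
      ∀ j, ∃ b : Fin 2 → ℝ, (∀ a, 0 < b a) ∧
        TwoNovikov.HasSimpleResidue (TwoNovikov.weylW x m n) (lam j : ℂ)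
          (fun a => (b a : ℂ)) := by
  obtain ⟨x, hx, rfl⟩ := TwoNovikov.exists_strictMono_extension h.1
  obtain ⟨m, hm, rfl⟩ := TwoNovikov.exists_pos_extension fun j => (h.2 j).1
  obtain ⟨n, hn, rfl⟩ := TwoNovikov.exists_pos_extension fun j => (h.2 j).2
  obtain ⟨r, hr, hr0, ⟨c, hc, hA⟩, hC⟩ := TwoNovikov.exists_roots_a hx hm hn N
  -- The induction lists the zeros increasingly; `rev` gives the decreasing order.
  refine ⟨fun j => r j.rev, fun i j hij => hr (Fin.rev_lt_rev.2 hij), fun j => hr0 _, ?_,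
    fun j => TwoNovikov.residue_weylW hx hm hn hr hr0 hc hA hC j.rev⟩
  ext z
  have hz := congrArg TwoNovikov.State.a (TwoNovikov.state_X_map_complex x m n z N)
  rw [TwoNovikov.mem_spectrumSet_iff_state_a m n hx, ← hz, TwoNovikov.State.map, hA]
  simp only [map_mul, map_prod, map_sub, Polynomial.aeval_C, Polynomial.aeval_X,
    Complex.coe_algebraMap, mul_eq_zero, Complex.ofReal_eq_zero, hc.ne', false_or,
    Finset.prod_eq_zero_iff, Finset.mem_univ, true_and, sub_eq_zero, Set.mem_range]
  exact ⟨fun ⟨i, hi⟩ => ⟨i.rev, by rw [Fin.rev_rev, hi]⟩, fun ⟨i, hi⟩ => ⟨i.rev, hi⟩⟩
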